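/- Let $\mathcal H$ be a separable complex Hilbert space, of finite or infinite dimension. A density operator on $\mathcal H$ is a positive trace class operator of trace one, and its von Neumann entropy is $S(\rho)=-\mathrm{Tr}[\rho\ln\rho]\in[0,\infty]$. Let $\mathcal S$ be the swap operator on $\mathcal H\otimes\mathcal H$, $\mathcal S(u\otimes v)=v\otimes u$. For $t\in[0,1]$ put $U_t=\sqrt t\,\mathbb 1+i\sqrt{1-t}\,\mathcal S$, and for density operators $\rho,\sigma$ on $\mathcal H$ let $$\rho\star_t\sigma=\mathrm{Tr}_2\bigl(U_t(\rho\otimes\sigma)U_t^*\bigr),$$ where $\mathrm{Tr}_2$ is the partial trace over the second factor. Then for all density operators $\rho,\sigma$ on $\mathcal H$ and all $t\in[0,1]$, the operator $\rho\star_t\sigma$ is a density operator and $$S(\rho\star_t\sigma)\ \ge\ t\,S(\rho)+(1-t)\,S(\sigma)$$ in $[0,\infty]$ (with $0\cdot\infty=0$). If moreover $t\in(0,1)$ and $S(\rho\star_t\sigma)<\infty$, then equality holds if and only if $\rho=\sigma$. All of this also holds with $\rho\star_t\sigma$ replaced by the operator $t\rho+(1-t)\sigma+i\sqrt{t(1-t)}\,[\rho,\sigma]$,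 where $[\rho,\sigma]=\rho\sigma-\sigma\rho$. -/

import Mathlib

open scoped TensorProduct ENNReal

universe u

noncomputable section

namespace QuantumEPI

variable {H : Type u} [NormedAddCommGroup H] [InnerProductSpace ℂ H]

/-- A chosen orthonormal (Hilbert) basis of the Hilbert space `H`. -/
def basisIndex (H : Type u) [NormedAddCommGroup H] [InnerProductSpace ℂ H] [CompleteSpace H] :
    Set H :=
  (exists_hilbertBasis ℂ H).choose

/-- A chosen orthonormal (Hilbert) basis of the Hilbert space `H`. -/
def hilbertBasis (H : Type u) [NormedAddCommGroup H] [InnerProductSpace ℂ H] [CompleteSpace H] :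
    HilbertBasis (basisIndex H) ℂ H :=
  (exists_hilbertBasis ℂ H).choose_spec.choose

/-- The trace `Tr A = ∑ ⟨e_i, A e_i⟩ ∈ [0, ∞]` of a positive operator `A`. It does not depend on
the orthonormal basis, see `trace_eq`. A positive operator is trace class iff this is finite. -/
def trace [CompleteSpace H] (A : H →L[ℂ] H) : ℝ≥0∞ :=
  ∑' i, ENNReal.ofReal (inner ℂ (hilbertBasis H i) (A (hilbertBasis H i))).re

theorem tsum_ofReal_norm_sq {ι : Type*} (b : HilbertBasis ι ℂ H) (x : H) :
    ∑' i, ENNReal.ofReal (‖inner ℂ (b i) x‖ ^ 2) = ENNReal.ofReal (‖x‖ ^ 2) := by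
  have h : HasSum (fun i => ‖inner ℂ (b i) x‖ ^ 2) (‖x‖ ^ 2) := by
    have h1 := Complex.hasSum_re (b.hasSum_inner_mul_inner x x)
    have h2 : (inner ℂ x x : ℂ).re = ‖x‖ ^ 2 := by
      rw [inner_self_eq_norm_sq_to_K]; norm_cast
    rw [h2] at h1
    convert h1 using 2 with i
    rw [← inner_conj_symm x (b i), ← Complex.normSq_eq_conj_mul_self, Complex.normSq_eq_norm_sq]
    norm_cast
  rw [← h.tsum_eq, ENNReal.ofReal_tsum_of_nonneg (fun i => by positivity) h.summable]

/-- The trace of a positive operator may be computed in any orthonormal basis. -/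
theorem trace_eq [CompleteSpace H] {ι : Type*} (b : HilbertBasis ι ℂ H) (A : H →L[ℂ] H)
    (hA : A.IsPositive) :
    trace A = ∑' i, ENNReal.ofReal (inner ℂ (b i) (A (b i))).re := by
  obtain ⟨B, hB, hBA⟩ : ∃ B : H →L[ℂ] H, IsSelfAdjoint B ∧ B * B = A := by
    have hA' : 0 ≤ A := (ContinuousLinearMap.nonneg_iff_isPositive A).2 hA
    exact ⟨CFC.sqrt A, (CFC.sqrt_nonneg A).isSelfAdjoint, CFC.sqrt_mul_sqrt_self A hA'⟩
  have hsym (x y : H) : inner ℂ x (B y) = inner ℂ (B x) y := by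
    rw [← ContinuousLinearMap.adjoint_inner_left, hB.adjoint_eq]
  have key (x : H) : (inner ℂ x (A x)).re = ‖B x‖ ^ 2 := by
    rw [← hBA, mul_apply_eq_comp, hsym, inner_self_eq_norm_sq_to_K]; norm_cast
  unfold trace
  simp_rw [key]
  simp_rw [← tsum_ofReal_norm_sq b (B (hilbertBasis H _)),
    ← tsum_ofReal_norm_sq (hilbertBasis H) (B (b _))]
  rw [ENNReal.tsum_comm]
  refine tsum_congr fun j => tsum_congr fun i => ?_
  rw [hsym, norm_inner_symm]

/-- Density operators (density matrices): positive operators of trace one. -/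
structure IsDensityOperator [CompleteSpace H] (ρ : H →L[ℂ] H) : Prop where
  isPositive : ρ.IsPositive
  trace_eq_one : trace ρ = 1

/-- The von Neumann entropy `S(ρ) = -Tr[ρ ln ρ] ∈ [0, ∞]` of a density operator, where
`-ρ ln ρ = h(ρ)` with `h x = -x ln x` (and `h 0 = 0`) is given by the continuous functional
calculus. The operator `h(ρ)` is positive as the spectrum of `ρ` lies in `[0, 1]`. -/
def vonNeumannEntropy [CompleteSpace H] (ρ : H →L[ℂ] H) : ℝ≥0∞ :=
  trace (cfc (fun x : ℝ => -(x * Real.log x)) ρ)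

/-- The Hilbert space tensor product `H ⊗ H`: the completion of the algebraic tensor product. -/
abbrev HilbertTensor (H : Type u) [NormedAddCommGroup H] [InnerProductSpace ℂ H] : Type u :=
  UniformSpace.Completion (H ⊗[ℂ] H)

/-- The elementary tensor `x ⊗ y` in the Hilbert space tensor product. -/
def tmul (x y : H) : HilbertTensor H := ((x ⊗ₜ[ℂ] y : H ⊗[ℂ] H) : HilbertTensor H)

/-- The operator `A ⊗ B` on `H ⊗ H`, with `(A ⊗ B) (x ⊗ y) = A x ⊗ B y`. -/
def tensorOp (A B : H →L[ℂ] H) : HilbertTensor H →L[ℂ] HilbertTensor H :=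
  (TensorProduct.mapL A B).completion

/-- The swap operator on `H ⊗ H`, with `S (x ⊗ y) = y ⊗ x`. -/
def swapOp (H : Type u) [NormedAddCommGroup H] [InnerProductSpace ℂ H] :
    HilbertTensor H →L[ℂ] HilbertTensor H :=
  ContinuousLinearMap.completion
    ((TensorProduct.commIsometry ℂ H H : H ⊗[ℂ] H ≃ₗᵢ[ℂ] H ⊗[ℂ] H) : H ⊗[ℂ] H →L[ℂ] H ⊗[ℂ] H)

theorem tensorOp_tmul (A B : H →L[ℂ] H) (x y : H) :
    tensorOp A B (tmul x y) = tmul (A x) (B y) := by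
  simp [tensorOp, tmul]

theorem swapOp_tmul (x y : H) : swapOp H (tmul x y) = tmul y x := by
  simp [swapOp, tmul]

/-- The partial swap `U_t = √t 1 + i √(1 - t) S` on `H ⊗ H`. -/
def partialSwap (H : Type u) [NormedAddCommGroup H] [InnerProductSpace ℂ H] (t : ℝ) :
    HilbertTensor H →L[ℂ] HilbertTensor H :=
  (√t : ℂ) • ContinuousLinearMap.id ℂ (HilbertTensor H) + (Complex.I * (√(1 - t) : ℂ)) • swapOp H

/-- `τ` is the partial trace over the second factor of the operator `T` on `H ⊗ H`:
`⟨x, τ y⟩ = ∑ ⟨x ⊗ e_i, T (y ⊗ e_i)⟩` for every orthonormal basis `e` of `H`. -/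
def IsPartialTrace (T : HilbertTensor H →L[ℂ] HilbertTensor H) (τ : H →L[ℂ] H) : Prop :=
  ∀ (ι : Type u) (b : HilbertBasis ι ℂ H) (x y : H),
    HasSum (fun i => inner ℂ (tmul x (b i)) (T (tmul y (b i)))) (inner ℂ x (τ y))

theorem IsPartialTrace.unique [CompleteSpace H] {T : HilbertTensor H →L[ℂ] HilbertTensor H}
    {τ τ' : H →L[ℂ] H} (h : IsPartialTrace T τ) (h' : IsPartialTrace T τ') : τ = τ' :=
  ContinuousLinearMap.ext fun y => ext_inner_left ℂ fun x =>
    (h _ (hilbertBasis H) x y).unique (h' _ (hilbertBasis H) x y)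

open Classical in
/-- The partial trace `Tr₂ T` over the second factor (zero if it does not exist, which cannot
happen for trace class `T`). -/
def partialTrace (T : HilbertTensor H →L[ℂ] HilbertTensor H) : H →L[ℂ] H :=
  if h : ∃ τ, IsPartialTrace T τ then h.choose else 0

/-- The partial swap convolution `ρ ⋆_t σ = Tr₂ (U_t (ρ ⊗ σ) U_t^*)`. -/
def partialSwapConv [CompleteSpace H] (t : ℝ) (ρ σ : H →L[ℂ] H) : H →L[ℂ] H :=
  partialTrace
    (partialSwap H t ∘L tensorOp ρ σ ∘L ContinuousLinearMap.adjoint (partialSwap H t))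

/-- The explicit operator `t ρ + (1 - t) σ + i √(t (1 - t)) [ρ, σ]`. -/
def commutatorConv (t : ℝ) (ρ σ : H →L[ℂ] H) : H →L[ℂ] H :=
  (t : ℂ) • ρ + ((1 - t : ℝ) : ℂ) • σ
    + (Complex.I * (√(t * (1 - t)) : ℂ)) • (ρ ∘L σ - σ ∘L ρ)

end QuantumEPI

end

noncomputable section

namespace QuantumEPI

variable {H : Type u} [NormedAddCommGroup H] [InnerProductSpace ℂ H]

/-! Write `τ` for `commutatorConv t ρ σ`. For an eigenvalue `x` in `[0, 1]`, `-x ln x` is the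
integral over `c ∈ (0, 1)` of `(min x c - c x) / c`. Summing over eigenvalues, `S(ρ) = ∫ (1 - c - Tr
(ρ - c)₊) / c dc`. The inequality therefore follows from `Tr (τ - c)₊ ≤ t Tr (ρ - c)₊ + (1 - t) Tr
(σ - c)₊` for each `c`, which is `excess_commutatorConv_le`.

Let `P` project onto the finite span of the eigenvectors of `τ` with eigenvalue at least `c`, and
let `Q = 1 - P`. Then `Tr (τ - c)₊ = Tr P(τ - c)P`. In the commutator term, `Tr PρPσP` is real, so
only the off-block parts `QρP` and `QσP` contribute; by AM-GM they cost at most `t ‖QρP‖² + (1 - t)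
‖QσP‖²` in Hilbert-Schmidt norm (`sum_im_inner_le`). It remains to treat each state separately and
show `Tr P(ρ - c)P + ‖QρP‖² ≤ Tr (ρ - c)₊`: this is `sum_re_inner_sub_le`, proved by splitting `ρ -
c` into positive and negative parts.

That bound leaves a surplus that is strictly positive as soon as some eigenvector in the block
overlaps an eigenvector of `ρ` with eigenvalue below `c`. If the entropies agree and are finite, the
surplus vanishes for almost every `c`, so eigenvectors of `ρ` meet only eigenvectors of `τ` with no
larger eigenvalue. Equality of traces then forces `ρ = τ`, and likewise `σ = τ`.

The partial swap convolution is `commutatorConv (1 - t) σ ρ`, so it is covered by the same result.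
-/

/-- Parseval's identity. -/
theorem hasSum_norm_inner_sq {ι : Type*} (b : HilbertBasis ι ℂ H) (x : H) :
    HasSum (fun i => ‖inner ℂ (b i) x‖ ^ 2) (‖x‖ ^ 2) := by
  have h1 := Complex.hasSum_re (b.hasSum_inner_mul_inner x x)
  have h2 : (inner ℂ x x : ℂ).re = ‖x‖ ^ 2 := by
    rw [inner_self_eq_norm_sq_to_K]; norm_cast
  rw [h2] at h1
  convert h1 using 2 with i
  rw [← inner_conj_symm x (b i), ← Complex.normSq_eq_conj_mul_self, Complex.normSq_eq_norm_sq]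
  norm_cast

/-- Distinct basis vectors are `√2` apart, so balls of radius `1/2` around them are disjoint.
Countability is what lets the sum over eigenvalues be exchanged with the integral over `c`. -/
theorem countable_of_hilbertBasis [TopologicalSpace.SeparableSpace H] {ι : Type*}
    (b : HilbertBasis ι ℂ H) : Countable ι := by
  refine Pairwise.countable_of_isOpen_disjoint (s := fun i => Metric.ball (b i) (1 / 2)) ?_
    (fun i => Metric.isOpen_ball) (fun i => Metric.nonempty_ball.2 (by norm_num))
  intro i j hij
  refine Metric.ball_disjoint_ball ?_
  have h : ‖b i - b j‖ ^ 2 = 2 := by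
    rw [@norm_sub_sq ℂ, b.orthonormal.1 i, b.orthonormal.1 j, b.orthonormal.2 hij]
    norm_num
  rw [dist_eq_norm]
  nlinarith [norm_nonneg (b i - b j)]

/-! ### Spectral theory of positive trace class operators -/

section Compact

variable [CompleteSpace H]

/-- A positive operator has a self-adjoint square root. -/
theorem exists_sqrt {A : H →L[ℂ] H} (hA : A.IsPositive) :
    ∃ B : H →L[ℂ] H, (∀ x y, inner ℂ x (B y) = inner ℂ (B x) y) ∧ B ∘L B = A := by
  have hA' : 0 ≤ A := (ContinuousLinearMap.nonneg_iff_isPositive A).2 hA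
  refine ⟨CFC.sqrt A, fun x y => ?_, CFC.sqrt_mul_sqrt_self A hA'⟩
  rw [← ContinuousLinearMap.adjoint_inner_left, (CFC.sqrt_nonneg A).isSelfAdjoint.adjoint_eq]

theorem hasSum_inner_of_trace {ι : Type*} (b : HilbertBasis ι ℂ H) {A : H →L[ℂ] H}
    (hA : A.IsPositive) (h : trace A ≠ ⊤) :
    HasSum (fun i => (inner ℂ (b i) (A (b i))).re) (trace A).toReal := by
  rw [trace_eq b A hA] at h ⊢
  have h0 : ∀ i, 0 ≤ (inner ℂ (b i) (A (b i))).re := fun i => hA.re_inner_nonneg_right (b i)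
  have h1 := (ENNReal.summable_toReal h).hasSum
  rw [← ENNReal.tsum_toReal_eq (fun i => ENNReal.ofReal_ne_top)] at h1
  simpa [ENNReal.toReal_ofReal, h0] using h1

/-- A positive operator of finite trace is compact. -/
theorem isCompactOperator_of_trace_ne_top {A : H →L[ℂ] H} (hA : A.IsPositive)
    (h : trace A ≠ ⊤) : IsCompactOperator A := by
  classical
  obtain ⟨B, hB, rfl⟩ := exists_sqrt hA
  set b := hilbertBasis H
  have hsum : Summable fun i => ‖B (b i)‖ ^ 2 := by
    refine (hasSum_inner_of_trace b hA h).summable.congr fun i => ?_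
    rw [ContinuousLinearMap.comp_apply, hB, inner_self_eq_norm_sq_to_K]
    norm_cast
  -- The square root is Hilbert-Schmidt. `F s` is its truncation `P_s B` to the coordinates in `s`,
  -- of finite rank, with operator-norm error at most the Hilbert-Schmidt tail.
  let F : Finset (basisIndex H) → H →L[ℂ] H := fun s =>
    ∑ i ∈ s, (innerSL ℂ (B (b i))).smulRight (b i)
  have hF : ∀ s, IsCompactOperator (F s) := by
    intro s
    have : F s ∈ compactOperator (RingHom.id ℂ) H H := by
      refine Submodule.sum_mem _ fun i _ => ?_
      have h1 : IsCompactOperator (innerSL ℂ (B (b i))) :=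
        isCompactOperator_of_locallyCompactSpace_dom _
      exact h1.clm_comp (ContinuousLinearMap.toSpanSingleton ℂ (b i))
    exact this
  have hFB : ∀ s, ‖F s - B‖ ≤ √(∑' i : { i // i ∉ s }, ‖B (b i)‖ ^ 2) := by
    intro s
    refine ContinuousLinearMap.opNorm_le_bound _ (Real.sqrt_nonneg _) fun x => ?_
    refine abs_le_of_sq_le_sq' ?_ (by positivity) |>.2
    rw [mul_pow, Real.sq_sqrt (tsum_nonneg fun i => by positivity)]
    have h1 : HasSum (Set.indicator {i | i ∉ s} fun i => ‖B (b i)‖ ^ 2)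
        (∑' i : { i // i ∉ s }, ‖B (b i)‖ ^ 2) := by
      rw [← hasSum_subtype_iff_indicator]
      exact (hsum.subtype _).hasSum
    refine hasSum_le (fun i => ?_) (hasSum_norm_inner_sq b ((F s - B) x)) (h1.mul_right (‖x‖ ^ 2))
    have h2 : inner ℂ (b i) (F s x) = if i ∈ s then inner ℂ (B (b i)) x else 0 := by
      simp only [F, sum_apply, ContinuousLinearMap.smulRight_apply, inner_sum,
        inner_smul_right, orthonormal_iff_ite.1 b.orthonormal, innerSL_apply_apply]
      simp
    rw [sub_apply, inner_sub_right, h2, hB]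
    by_cases hi : i ∈ s
    · simp [hi]
    · simp only [hi, if_false, zero_sub, norm_neg, Set.indicator, Set.mem_ofPred_eq,
        not_false_eq_true, if_true, ← mul_pow]
      gcongr
      exact norm_inner_le_norm _ _
  have hlim : Filter.Tendsto F Filter.atTop (nhds B) := by
    rw [tendsto_iff_norm_sub_tendsto_zero]
    refine squeeze_zero (fun s => norm_nonneg _) hFB ?_
    have := (tendsto_tsum_compl_atTop_zero fun i => ‖B (b i)‖ ^ 2)
    have := (Real.continuous_sqrt.tendsto 0).comp this
    rwa [Real.sqrt_zero] at this
  have hBc : IsCompactOperator B :=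
    isCompactOperator_of_tendsto hlim (Filter.Eventually.of_forall hF)
  exact hBc.clm_comp B

/-- A positive operator of finite trace has an orthonormal basis of eigenvectors. -/
theorem exists_eigenbasis {A : H →L[ℂ] H} (hA : A.IsPositive) (h : trace A ≠ ⊤) :
    ∃ (ι : Type u) (b : HilbertBasis ι ℂ H) (r : ι → ℝ), ∀ i, A (b i) = (r i : ℂ) • b i := by
  have hsymm : A.toLinearMap.IsSymmetric := hA.isSymmetric
  have hbot := ContinuousLinearMap.orthogonalComplement_iSup_eigenspaces_eq_bot
    (isCompactOperator_of_trace_ne_top hA h) hsymm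
  let E : ℂ → Submodule ℂ H := fun μ => Module.End.eigenspace (A : Module.End ℂ H) μ
  have hE : ∀ μ, IsClosed (E μ : Set H) := fun μ => by
    have : (E μ : Set H) = {x | A x = μ • x} := by
      ext x; simp [E]
    rw [this]
    exact isClosed_eq A.continuous (continuous_const_smul μ)
  have : ∀ μ, CompleteSpace (E μ) := fun μ => (hE μ).completeSpace_coe
  -- The basis is the union of orthonormal bases of all eigenspaces, the kernel included.
  have hon := hsymm.orthogonalFamily_eigenspaces.orthonormal_sigma_orthonormal
    (v_family := fun μ => hilbertBasis (E μ)) (fun μ => (hilbertBasis (E μ)).orthonormal)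
  refine ⟨_, HilbertBasis.mkOfOrthogonalEqBot hon ?_, fun i => i.1.re, fun i => ?_⟩
  · rw [Submodule.eq_bot_iff]
    intro x hx
    rw [← Submodule.mem_bot ℂ, ← hbot, Submodule.mem_orthogonal]
    intro y hy
    refine Submodule.iSup_induction E (motive := fun y => inner ℂ y x = 0) hy ?_
      (inner_zero_left _) (fun y z hy hz => by rw [inner_add_left, hy, hz, add_zero])
    intro μ y hy
    have h1 : HasSum _ _ := (hilbertBasis (E μ)).hasSum_repr ⟨y, hy⟩
    have h2 := (h1.mapL (E μ).subtypeL).mapL (innerSL ℂ x)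
    rw [← inner_conj_symm]
    refine (map_eq_zero _).2 ?_
    refine (h2.unique ?_)
    convert hasSum_zero with i
    rw [map_smul, map_smul]
    refine smul_eq_zero_of_right _ ?_
    rw [innerSL_apply_apply, ← inner_conj_symm]
    refine (map_eq_zero _).2 ?_
    exact (Submodule.mem_orthogonal _ _).1 hx _ (Submodule.subset_span ⟨⟨μ, i⟩, rfl⟩)
  · rw [HilbertBasis.coe_mkOfOrthogonalEqBot]
    have hmem := (hilbertBasis (E i.1) i.2).2
    have h1 : A (hilbertBasis (E i.1) i.2 : H) = i.1 • (hilbertBasis (E i.1) i.2 : H) :=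
      Module.End.mem_eigenspace_iff.1 hmem
    have h0 : (hilbertBasis (E i.1) i.2 : H) ≠ 0 := by
      intro h0
      have := (hilbertBasis (E i.1)).orthonormal.1 i.2
      rw [← Submodule.norm_coe, h0, norm_zero] at this
      exact zero_ne_one this
    have h2 : (starRingEnd ℂ) i.1 = i.1 :=
      hsymm.conj_eigenvalue_eq_self (Module.End.hasEigenvalue_of_hasEigenvector ⟨hmem, h0⟩)
    rw [Complex.conj_eq_iff_re.1 h2]
    exact h1

/-- The continuous functional calculus acts on eigenvectors through the eigenvalue. -/
theorem cfc_apply_of_eigenvector {A : H →L[ℂ] H} (hA : IsSelfAdjoint A) {v : H} {l : ℝ}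
    (hv : A v = (l : ℂ) • v) (f : ℝ → ℝ) (hf : Continuous f) :
    cfc f A v = (f l : ℂ) • v := by
  rcases eq_or_ne v 0 with rfl | hv0
  · simp
  have hl : l ∈ spectrum ℝ A := by
    intro hu
    obtain ⟨T, hT⟩ := hu.exists_left_inv
    have h1 : (algebraMap ℝ (H →L[ℂ] H) l - A) v = 0 := by
      rw [sub_apply, hv, Algebra.algebraMap_eq_smul_one]
      simp
    have h2 := congrArg (fun S : H →L[ℂ] H => S v) hT
    simp only [mul_apply_eq_comp, h1, map_zero, one_apply_eq_self] at h2
    exact hv0 h2.symm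
  rw [cfc_apply f A hA hf.continuousOn]
  have key : ∀ g : C(spectrum ℝ A, ℝ), cfcHom (R := ℝ) hA g v = (g ⟨l, hl⟩ : ℂ) • v := by
    intro g
    -- Stone-Weierstrass: the relation holds for constants and the identity, passes to sums and
    -- products, and is closed under uniform limits.
    induction g using ContinuousMap.induction_on_of_compact with
    | const r =>
      have : ContinuousMap.const (spectrum ℝ A) r = algebraMap ℝ C(spectrum ℝ A, ℝ) r := rfl
      rw [this, AlgHomClass.commutes, Algebra.algebraMap_eq_smul_one]
      simp [Algebra.algebraMap_eq_smul_one]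
    | id =>
      rw [cfcHom_id (R := ℝ) hA]
      exact hv
    | star_id =>
      rw [star_trivial, cfcHom_id (R := ℝ) hA]
      exact hv
    | add f g hf hg => rw [map_add]; simp [hf, hg, add_smul]
    | mul f g hf hg => 
      rw [map_mul, mul_apply_eq_comp, hg, map_smul, hf, smul_smul, ContinuousMap.mul_apply,
        Complex.ofReal_mul, mul_comm]
    | frequently f hf =>
      have hc : IsClosed {g : C(spectrum ℝ A, ℝ) |
          cfcHom (R := ℝ) hA g v = (g ⟨l, hl⟩ : ℂ) • v} := by
        refine isClosed_eq ?_ ?_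
        · exact (ContinuousLinearMap.apply ℂ H v).continuous.comp (cfcHom_continuous hA)
        · fun_prop
      exact hc.mem_of_frequently_of_tendsto hf Filter.tendsto_id
  exact key _

end Compact

/-! ### Operators diagonal in an orthonormal basis -/

section Eigenbasis

variable {κ : Type*} (b : HilbertBasis κ ℂ H) {A : H →L[ℂ] H} {r : κ → ℝ}

theorem inner_eigenvector (hA : A.toLinearMap.IsSymmetric) {v : H} {l : ℝ}
    (hv : A v = (l : ℂ) • v) (x : H) : inner ℂ v (A x) = (l : ℂ) * inner ℂ v x := by
  have h : inner ℂ (A v) x = inner ℂ v (A x) := hA v x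
  rw [← h, hv, inner_smul_left, Complex.conj_ofReal]

theorem hasSum_re_inner_eigenbasis (hA : A.toLinearMap.IsSymmetric)
    (hr : ∀ k, A (b k) = (r k : ℂ) • b k) (x : H) :
    HasSum (fun k => r k * ‖inner ℂ (b k) x‖ ^ 2) (inner ℂ x (A x)).re := by
  convert Complex.hasSum_re (b.hasSum_inner_mul_inner x (A x)) using 2 with k
  rw [inner_eigenvector hA (hr k), mul_left_comm, ← inner_conj_symm x (b k),
    ← Complex.normSq_eq_conj_mul_self, Complex.normSq_eq_norm_sq]
  norm_cast

theorem hasSum_norm_sq_eigenbasis (hA : A.toLinearMap.IsSymmetric)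
    (hr : ∀ k, A (b k) = (r k : ℂ) • b k) (x : H) :
    HasSum (fun k => r k ^ 2 * ‖inner ℂ (b k) x‖ ^ 2) (‖A x‖ ^ 2) := by
  convert hasSum_norm_inner_sq b (A x) using 2 with k
  rw [inner_eigenvector hA (hr k), norm_mul, mul_pow, Complex.norm_real, Real.norm_eq_abs, sq_abs]

theorem isPositive_of_eigenbasis (hA : A.toLinearMap.IsSymmetric)
    (hr : ∀ k, A (b k) = (r k : ℂ) • b k) (h0 : ∀ k, 0 ≤ r k) : A.IsPositive := by
  refine ⟨hA, fun x => ?_⟩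
  have h : inner ℂ (A x) x = inner ℂ x (A x) := hA x x
  rw [ContinuousLinearMap.reApplyInnerSelf_apply, h]
  exact (hasSum_re_inner_eigenbasis b hA hr x).nonneg fun k => mul_nonneg (h0 k) (by positivity)

/-- This is `A² ≤ A`, from `r² ≤ r` on `[0, 1]`. It is what makes the quadratic off-block terms
controllable by linear ones. -/
theorem norm_sq_le_re_inner_of_eigenbasis (hA : A.toLinearMap.IsSymmetric)
    (hr : ∀ k, A (b k) = (r k : ℂ) • b k) (h0 : ∀ k, 0 ≤ r k) (h1 : ∀ k, r k ≤ 1) (x : H) :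
    ‖A x‖ ^ 2 ≤ (inner ℂ x (A x)).re :=
  hasSum_le (fun k => mul_le_mul_of_nonneg_right (by nlinarith [h0 k, h1 k]) (by positivity))
    (hasSum_norm_sq_eigenbasis b hA hr x) (hasSum_re_inner_eigenbasis b hA hr x)

theorem re_inner_eigenvector (hr : ∀ k, A (b k) = (r k : ℂ) • b k) (k : κ) :
    (inner ℂ (b k) (A (b k))).re = r k := by
  rw [hr, inner_smul_right, inner_self_eq_norm_sq_to_K, b.orthonormal.1 k]
  simp

variable [CompleteSpace H]

theorem cfc_isSymmetric (f : ℝ → ℝ) (A : H →L[ℂ] H) : (cfc f A).toLinearMap.IsSymmetric :=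
  ContinuousLinearMap.isSelfAdjoint_iff_isSymmetric.1 (cfc_predicate f A)

theorem trace_cfc_eigenbasis (hA : IsSelfAdjoint A) (hr : ∀ k, A (b k) = (r k : ℂ) • b k)
    {f : ℝ → ℝ} (hf : Continuous f) (h0 : ∀ k, 0 ≤ f (r k)) :
    trace (cfc f A) = ∑' k, ENNReal.ofReal (f (r k)) := by
  have h : ∀ k, cfc f A (b k) = (f (r k) : ℂ) • b k := fun k =>
    cfc_apply_of_eigenvector hA (hr k) f hf
  rw [trace_eq b _ (isPositive_of_eigenbasis b (cfc_isSymmetric f A) h h0)]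
  exact tsum_congr fun k => by rw [re_inner_eigenvector b (r := fun k => f (r k)) h]

end Eigenbasis

/-! ### The entropy as an integral of `Tr (ρ - c)₊` -/

section Entropy

variable [CompleteSpace H] {κ : Type*} (b : HilbertBasis κ ℂ H) {ρ : H →L[ℂ] H} {r : κ → ℝ}

namespace IsDensityOperator

theorem eigenvalue_nonneg (hρ : IsDensityOperator ρ) (hr : ∀ k, ρ (b k) = (r k : ℂ) • b k)
    (k : κ) : 0 ≤ r k := by
  rw [← re_inner_eigenvector b hr k]
  exact hρ.isPositive.re_inner_nonneg_right (b k)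

theorem hasSum_inner (hρ : IsDensityOperator ρ) :
    HasSum (fun k => (inner ℂ (b k) (ρ (b k))).re) 1 := by
  simpa [hρ.trace_eq_one] using
    hasSum_inner_of_trace b hρ.isPositive (by simp [hρ.trace_eq_one])

theorem hasSum_eigenvalue (hρ : IsDensityOperator ρ) (hr : ∀ k, ρ (b k) = (r k : ℂ) • b k) :
    HasSum r 1 := by
  simpa only [re_inner_eigenvector b hr] using hρ.hasSum_inner b

theorem eigenvalue_le_one (hρ : IsDensityOperator ρ) (hr : ∀ k, ρ (b k) = (r k : ℂ) • b k)
    (k : κ) : r k ≤ 1 :=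
  le_hasSum (hρ.hasSum_eigenvalue b hr) k fun j _ => hρ.eigenvalue_nonneg b hr j

theorem exists_eigenbasis (hρ : IsDensityOperator ρ) :
    ∃ (ι : Type u) (b : HilbertBasis ι ℂ H) (r : ι → ℝ), ∀ i, ρ (b i) = (r i : ℂ) • b i :=
  QuantumEPI.exists_eigenbasis hρ.isPositive (by simp [hρ.trace_eq_one])

end IsDensityOperator

/-- The sum `∑ (r_k - c)₊`. -/
def excess (r : κ → ℝ) (c : ℝ) : ℝ := ∑' k, max (r k - c) 0

theorem summable_excess {r : κ → ℝ} (h0 : ∀ k, 0 ≤ r k) (hs : Summable r) {c : ℝ} (hc : 0 ≤ c) :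
    Summable fun k => max (r k - c) 0 :=
  hs.of_nonneg_of_le (fun _ => le_max_right _ _) fun k => max_le (by linarith) (h0 k)

/-- Since `x - (x - c)₊ = min x c`, the integrand equals `x / max c x - x`, which is continuous for
`x > 0`. It is `1 - x` on `(0, x)` and `x / c - x` on `(x, 1)`; the logarithm comes from the second
piece. -/
theorem negMulLog_eq_lintegral {x : ℝ} (h0 : 0 ≤ x) (h1 : x ≤ 1) :
    ENNReal.ofReal (-(x * Real.log x)) =
      ∫⁻ c in Set.Ioo (0 : ℝ) 1, ENNReal.ofReal ((x - max (x - c) 0 - c * x) / c) := by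
  rcases h0.eq_or_lt with rfl | hx
  · rw [MeasureTheory.setLIntegral_congr_fun (g := fun _ => 0) measurableSet_Ioo]
    · simp
    · intro c hc
      simp [hc.1.le]
  have hpos : ∀ c, 0 < max c x := fun c => lt_max_of_lt_right hx
  have hcont : Continuous fun c : ℝ => x / max c x - x :=
    (continuous_const.div (continuous_id.max continuous_const) fun c => (hpos c).ne').sub
      continuous_const
  have hint : ∫ c in (0 : ℝ)..1, (x / max c x - x) = -(x * Real.log x) := by
    rw [← intervalIntegral.integral_add_adjacent_intervals (b := x)
      (hcont.intervalIntegrable _ _) (hcont.intervalIntegrable _ _)]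
    have e1 : ∫ c in (0 : ℝ)..x, (x / max c x - x) = ∫ c in (0 : ℝ)..x, (1 - x) := by
      refine intervalIntegral.integral_congr fun c hc => ?_
      rw [Set.uIcc_of_le h0] at hc
      simp only [max_eq_right hc.2, div_self hx.ne']
    have e2 : ∫ c in x..1, (x / max c x - x) = ∫ c in x..1, (x * c⁻¹ - x) := by
      refine intervalIntegral.integral_congr fun c hc => ?_
      rw [Set.uIcc_of_le h1] at hc
      simp only [max_eq_left hc.1, div_eq_mul_inv]
    have hn : (0 : ℝ) ∉ Set.uIcc x 1 := by
      rw [Set.uIcc_of_le h1]; exact fun h => absurd h.1 (not_le.2 hx)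
    rw [e1, e2, intervalIntegral.integral_sub
      ((intervalIntegral.intervalIntegrable_inv (fun c hc h => hn (h ▸ hc))
        continuousOn_id).const_mul x)
      intervalIntegrable_const, intervalIntegral.integral_const_mul, integral_inv hn]
    simp
    ring
  rw [← hint, intervalIntegral.integral_of_le zero_le_one, MeasureTheory.integral_Ioc_eq_integral_Ioo,
    MeasureTheory.ofReal_integral_eq_lintegral_ofReal]
  · refine MeasureTheory.setLIntegral_congr_fun measurableSet_Ioo fun c hc => ?_
    have hc0 := hc.1
    congr 1
    rcases le_total c x with h | h
    · rw [max_eq_right h, max_eq_left (by linarith)]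
      field_simp
      ring
    · rw [max_eq_left h, max_eq_right (by linarith)]
      field_simp
      ring
  · exact (hcont.integrableOn_Icc (a := 0) (b := 1)).mono_set Set.Ioo_subset_Icc_self
  · refine (MeasureTheory.ae_restrict_iff' measurableSet_Ioo).2 (Filter.Eventually.of_forall ?_)
    intro c hc
    simp only [Pi.zero_apply, sub_nonneg]
    rw [le_div_iff₀ (hpos c)]
    have : max c x ≤ 1 := max_le hc.2.le h1
    nlinarith

/-- The entropy is an integral of the concave functionals `1 - c - Tr (ρ - c)₊`. -/
theorem vonNeumannEntropy_eq_lintegral [Countable κ] (hρ : IsDensityOperator ρ)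
    (hr : ∀ k, ρ (b k) = (r k : ℂ) • b k) :
    vonNeumannEntropy ρ =
      ∫⁻ c in Set.Ioo (0 : ℝ) 1, ENNReal.ofReal ((1 - c - excess r c) / c) := by
  have h0 := hρ.eigenvalue_nonneg b hr
  have h1 := hρ.eigenvalue_le_one b hr
  have hs := hρ.hasSum_eigenvalue b hr
  rw [vonNeumannEntropy, trace_cfc_eigenbasis b hρ.isPositive.isSelfAdjoint hr
    (f := fun x => -(x * Real.log x)) Real.continuous_mul_log.neg
    fun k => by nlinarith [Real.log_nonpos (h0 k) (h1 k), h0 k]]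
  rw [tsum_congr fun k => negMulLog_eq_lintegral (h0 k) (h1 k), ← MeasureTheory.lintegral_tsum]
  · refine MeasureTheory.setLIntegral_congr_fun measurableSet_Ioo fun c hc => ?_
    have hsum : HasSum (fun k => (r k - max (r k - c) 0 - c * r k) / c)
        ((1 - excess r c - c * 1) / c) :=
      ((hs.sub (summable_excess h0 hs.summable hc.1.le).hasSum).sub (hs.mul_left c)).div_const c
    rw [← ENNReal.ofReal_tsum_of_nonneg _ hsum.summable, hsum.tsum_eq]
    · congr 2; ring
    · intro k
      refine div_nonneg ?_ hc.1.le
      rcases max_cases (r k - c) 0 with h | h <;> rw [h.1] <;>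
        nlinarith [h0 k, h1 k, hc.1, hc.2]
  · intro k
    fun_prop

theorem excess_nonneg (r : κ → ℝ) (c : ℝ) : 0 ≤ excess r c :=
  tsum_nonneg fun _ => le_max_right _ _

theorem excess_le {r : κ → ℝ} (h0 : ∀ k, 0 ≤ r k) (h1 : ∀ k, r k ≤ 1) (hs : HasSum r 1) {c : ℝ}
    (hc : 0 ≤ c) (hc1 : c ≤ 1) : excess r c ≤ 1 - c := by
  have h := hs.mul_left (1 - c)
  rw [mul_one] at h
  refine hasSum_le (fun k => max_le ?_ ?_) (summable_excess h0 hs.summable hc).hasSum h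
  · nlinarith [h0 k, h1 k]
  · exact mul_nonneg (by linarith) (h0 k)

end Entropy

/-! ### Compression to a finite block and its complement -/

section OffProj

variable {ι : Type*} {e : ι → H} {J : Finset ι}

/-- The projection onto the orthogonal complement of the vectors `e j`, `j ∈ J`. -/
def offProj (e : ι → H) (J : Finset ι) : H →ₗ[ℂ] H :=
  LinearMap.id - ∑ m ∈ J, (innerₛₗ ℂ (e m)).smulRight (e m)

theorem offProj_apply (x : H) : offProj e J x = x - ∑ m ∈ J, inner ℂ (e m) x • e m := by
  simp [offProj]

open Classical in
theorem inner_offProj_right (he : Orthonormal ℂ e) (m : ι) (x : H) :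
    inner ℂ (e m) (offProj e J x) = if m ∈ J then 0 else inner ℂ (e m) x := by
  rw [offProj_apply, inner_sub_right, inner_sum]
  simp only [inner_smul_right, orthonormal_iff_ite.1 he]
  by_cases hm : m ∈ J <;> simp [hm]

theorem inner_offProj_offProj (he : Orthonormal ℂ e) (x y : H) :
    inner ℂ (offProj e J x) (offProj e J y)
      = inner ℂ x y - ∑ m ∈ J, inner ℂ x (e m) * inner ℂ (e m) y := by
  have h : inner ℂ (offProj e J x) (offProj e J y) = inner ℂ x (offProj e J y) := by
    rw [offProj_apply x, inner_sub_left, sum_inner, Finset.sum_eq_zero, sub_zero]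
    intro m hm
    rw [inner_smul_left, inner_offProj_right he, if_pos hm, mul_zero]
  rw [h, offProj_apply, inner_sub_right, inner_sum]
  simp only [inner_smul_right, mul_comm]

theorem offProj_basis (he : Orthonormal ℂ e) {j : ι} (hj : j ∈ J) : offProj e J (e j) = 0 := by
  classical
  rw [offProj_apply]
  simp [orthonormal_iff_ite.1 he, hj]

theorem norm_offProj_sq (he : Orthonormal ℂ e) (x : H) :
    ‖offProj e J x‖ ^ 2 = ‖x‖ ^ 2 - ∑ m ∈ J, ‖inner ℂ (e m) x‖ ^ 2 := by
  have h := congrArg Complex.re (inner_offProj_offProj (J := J) he x x)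
  rw [inner_self_eq_norm_sq_to_K, inner_self_eq_norm_sq_to_K] at h
  have h2 : ∀ m, inner ℂ x (e m) * inner ℂ (e m) x = ((‖inner ℂ (e m) x‖ ^ 2 : ℝ) : ℂ) := by
    intro m
    rw [← inner_conj_symm x (e m), ← Complex.normSq_eq_conj_mul_self, Complex.normSq_eq_norm_sq]
  simp only [h2, ← Complex.ofReal_sum] at h
  exact_mod_cast h

/-- The commutator terms inside a block cancel, so that they are bounded by the parts of the two
operators off the block. -/
theorem sum_im_inner_le (he : Orthonormal ℂ e) {X Y : H →L[ℂ] H}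
    (hX : X.toLinearMap.IsSymmetric) (hY : Y.toLinearMap.IsSymmetric) (α β : ℝ) :
    ∑ j ∈ J, -(2 * α * β * (inner ℂ (X (e j)) (Y (e j))).im)
      ≤ ∑ j ∈ J, (α ^ 2 * ‖offProj e J (X (e j))‖ ^ 2 + β ^ 2 * ‖offProj e J (Y (e j))‖ ^ 2) := by
  have hX' : ∀ x y, inner ℂ (X x) y = inner ℂ x (X y) := hX
  have hY' : ∀ x y, inner ℂ (Y x) y = inner ℂ x (Y y) := hY
  -- The trace of a product of two self-adjoint blocks is real: conjugation amounts to exchanging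
  -- the two summation indices.
  have h0 : (∑ j ∈ J, ∑ m ∈ J, inner ℂ (X (e j)) (e m) * inner ℂ (e m) (Y (e j))).im = 0 := by
    rw [← Complex.conj_eq_iff_im, map_sum, Finset.sum_comm]
    refine Finset.sum_congr rfl fun j _ => ?_
    rw [map_sum]
    refine Finset.sum_congr rfl fun m _ => ?_
    rw [map_mul, inner_conj_symm, inner_conj_symm, ← hX', hY']
  have h1 : ∑ j ∈ J, (inner ℂ (X (e j)) (Y (e j))).im
      = ∑ j ∈ J, (inner ℂ (offProj e J (X (e j))) (offProj e J (Y (e j)))).im := by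
    simp only [inner_offProj_offProj he, Complex.sub_im, Finset.sum_sub_distrib]
    rw [Complex.im_sum] at h0
    rw [h0, sub_zero]
  rw [Finset.sum_neg_distrib, ← Finset.mul_sum, h1, Finset.mul_sum, ← Finset.sum_neg_distrib]
  refine Finset.sum_le_sum fun j _ => ?_
  set x := offProj e J (X (e j))
  set y := offProj e J (Y (e j))
  -- The factor `I` turns the real cross term of the square into the imaginary part.
  have h2 : ‖(α : ℂ) • x - (Complex.I * β) • y‖ ^ 2
      = α ^ 2 * ‖x‖ ^ 2 + β ^ 2 * ‖y‖ ^ 2 + 2 * α * β * (inner ℂ x y).im := by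
    rw [@norm_sub_sq ℂ, norm_smul, norm_smul, inner_smul_left, inner_smul_right]
    simp [mul_pow]
    ring
  nlinarith [sq_nonneg ‖(α : ℂ) • x - (Complex.I * β) • y‖]

end OffProj

theorem ext_hilbertBasis {κ : Type*} (b : HilbertBasis κ ℂ H) {S T : H →L[ℂ] H}
    (h : ∀ k, S (b k) = T (b k)) : S = T := by
  refine ContinuousLinearMap.ext_on
    (Submodule.dense_iff_topologicalClosure_eq_top.2 b.dense_span) ?_
  rintro _ ⟨k, rfl⟩
  exact h k

/-! ### The one-state block inequality -/

section Block

variable [CompleteSpace H] {κ ι : Type*} (b : HilbertBasis κ ℂ H) (e : HilbertBasis ι ℂ H)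
  {ρ : H →L[ℂ] H} {r : κ → ℝ}

/-- By symmetry of the matrix of `B`, the off-block entries in the columns `j ∈ J` are those in the
columns `m ∉ J` with row in `J`. Their squares sum to at most `∑ ‖B e_m‖² ≤ ∑ ⟨e_m, B e_m⟩` over `m
∉ J`, which is exactly the part of the trace outside `J`. -/
theorem sum_norm_offProj_sq_le (J : Finset ι) {B : H →L[ℂ] H} (hB : B.IsPositive)
    (hB1 : ∀ x, ‖B x‖ ^ 2 ≤ (inner ℂ x (B x)).re) (hBt : trace B ≠ ⊤) :
    ∑ j ∈ J, ((inner ℂ (e j) (B (e j))).re + ‖offProj e J (B (e j))‖ ^ 2)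
      ≤ (trace B).toReal := by
  classical
  have hsymm : ∀ x y, inner ℂ (B x) y = inner ℂ x (B y) := hB.isSymmetric
  have h1 : HasSum (fun m => ∑ j ∈ J, ‖inner ℂ (e m) (offProj e J (B (e j)))‖ ^ 2)
      (∑ j ∈ J, ‖offProj e J (B (e j))‖ ^ 2) :=
    hasSum_sum fun j _ => hasSum_norm_inner_sq e _
  have h2 : HasSum (fun m => if m ∈ J then (inner ℂ (e m) (B (e m))).re else 0)
      (∑ j ∈ J, (inner ℂ (e j) (B (e j))).re) := by
    rw [← Finset.sum_congr rfl fun j hj => if_pos hj]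
    exact hasSum_sum_of_ne_finset_zero fun m hm => if_neg hm
  rw [Finset.sum_add_distrib]
  refine hasSum_le (fun m => ?_) (h2.add h1) (hasSum_inner_of_trace e hB hBt)
  by_cases hm : m ∈ J
  · simp [inner_offProj_right e.orthonormal, hm]
  · simp only [inner_offProj_right e.orthonormal, hm, if_false, zero_add]
    refine le_trans ?_ (hB1 (e m))
    rw [← (hasSum_norm_inner_sq e (B (e m))).tsum_eq]
    refine le_trans (Finset.sum_le_sum fun j _ => le_of_eq ?_)
      ((hasSum_norm_inner_sq e (B (e m))).summable.sum_le_tsum J fun _ _ => by positivity)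
    rw [← hsymm, norm_inner_symm]

/-- Write `ρ = c + (1 - c) B - c X` with `B = (ρ - c)₊ / (1 - c)` and `X = (c - ρ)₊ / c`, both
between `0` and `1`. Convexity of the squared norm splits the off-block term with weights `1 - c`
and `c`. The `B` terms add up to at most `(1 - c) Tr B = Tr (ρ - c)₊`; the `X` terms are nonpositive
with slack `c ⟨e_j, X e_j⟩²`. This slack is the last summand on the left and drives the equality
case. -/
theorem sum_re_inner_sub_le (hρ : IsDensityOperator ρ) (hr : ∀ k, ρ (b k) = (r k : ℂ) • b k)
    {c : ℝ} (hc : c ∈ Set.Ioo (0 : ℝ) 1) (J : Finset ι) :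
    ∑ j ∈ J, ((inner ℂ (e j) (ρ (e j))).re - c + ‖offProj e J (ρ (e j))‖ ^ 2
        + c * (∑' k, max (c - r k) 0 / c * ‖inner ℂ (b k) (e j)‖ ^ 2) ^ 2)
      ≤ excess r c := by
  obtain ⟨hc0, hc1⟩ := hc
  have h0 := hρ.eigenvalue_nonneg b hr
  have h1 := hρ.eigenvalue_le_one b hr
  have hs := hρ.hasSum_eigenvalue b hr
  have hsa := hρ.isPositive.isSelfAdjoint
  have hc1' : 0 < 1 - c := by linarith
  set f : ℝ → ℝ := fun x => max (x - c) 0 / (1 - c) with hf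
  set g : ℝ → ℝ := fun x => max (c - x) 0 / c with hg
  have hfc : Continuous f := by fun_prop
  have hgc : Continuous g := by fun_prop
  set B := cfc f ρ
  set X := cfc g ρ
  have hB : ∀ k, B (b k) = (f (r k) : ℂ) • b k := fun k =>
    cfc_apply_of_eigenvector hsa (hr k) f hfc
  have hX : ∀ k, X (b k) = (g (r k) : ℂ) • b k := fun k =>
    cfc_apply_of_eigenvector hsa (hr k) g hgc
  have hBs := cfc_isSymmetric f ρ
  have hXs := cfc_isSymmetric g ρ
  have hf0 : ∀ k, 0 ≤ f (r k) := fun k => by positivity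
  have hg0 : ∀ k, 0 ≤ g (r k) := fun k => by positivity
  have hf1 : ∀ k, f (r k) ≤ 1 := fun k =>
    (div_le_one hc1').2 (max_le (by linarith [h1 k]) hc1'.le)
  have hg1 : ∀ k, g (r k) ≤ 1 := fun k =>
    (div_le_one hc0).2 (max_le (by linarith [h0 k]) hc0.le)
  have hBpos := isPositive_of_eigenbasis b hBs hB hf0
  have hB1 := norm_sq_le_re_inner_of_eigenbasis b hBs hB hf0 hf1
  have hX1 := norm_sq_le_re_inner_of_eigenbasis b hXs hX hg0 hg1
  have hfsum : Summable fun k => f (r k) := (summable_excess h0 hs.summable hc0.le).div_const _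
  have htr : trace B = ENNReal.ofReal (excess r c / (1 - c)) := by
    rw [trace_cfc_eigenbasis b hsa hr hfc hf0, ← ENNReal.ofReal_tsum_of_nonneg hf0 hfsum,
      excess, tsum_div_const]
  have hBt := sum_norm_offProj_sq_le e J hBpos hB1 (by rw [htr]; exact ENNReal.ofReal_ne_top)
  rw [htr, ENNReal.toReal_ofReal (div_nonneg (excess_nonneg r c) hc1'.le), le_div_iff₀ hc1'] at hBt
  have hdec : ∀ x, ρ x = (c : ℂ) • x + (((1 - c : ℝ) : ℂ) • B x - (c : ℂ) • X x) := by
    intro x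
    have h : ρ = (c : ℂ) • ContinuousLinearMap.id ℂ H
        + (((1 - c : ℝ) : ℂ) • B - (c : ℂ) • X) := by
      refine ext_hilbertBasis b fun k => ?_
      simp only [add_apply, sub_apply, smul_apply,
        ContinuousLinearMap.id_apply, hB, hX, hr, smul_smul, ← sub_smul, ← add_smul]
      congr 1
      norm_cast
      simp only [hf, hg]
      rw [mul_div_cancel₀ _ hc1'.ne', mul_div_cancel₀ _ hc0.ne']
      rcases le_total c (r k) with h | h
      · rw [max_eq_left (by linarith), max_eq_right (by linarith)]; ring
      · rw [max_eq_right (by linarith), max_eq_left (by linarith)]; ring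
    exact congrArg (fun T : H →L[ℂ] H => T x) h
  refine le_trans ?_ hBt
  rw [Finset.sum_mul]
  refine Finset.sum_le_sum fun j hj => ?_
  have hXj : (inner ℂ (e j) (X (e j))).re = ∑' k, g (r k) * ‖inner ℂ (b k) (e j)‖ ^ 2 :=
    (hasSum_re_inner_eigenbasis b hXs hX (e j)).tsum_eq.symm
  rw [← hXj]
  -- From `‖X e_j‖² ≤ ⟨e_j, X e_j⟩`, the projection onto the block removes at least the diagonal
  -- entry, since `j ∈ J`.
  have hw : ‖offProj e J (X (e j))‖ ^ 2
      ≤ (inner ℂ (e j) (X (e j))).re - (inner ℂ (e j) (X (e j))).re ^ 2 := by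
    rw [norm_offProj_sq e.orthonormal]
    have h2 : ‖inner ℂ (e j) (X (e j))‖ ^ 2 ≤ ∑ m ∈ J, ‖inner ℂ (e m) (X (e j))‖ ^ 2 :=
      Finset.single_le_sum (f := fun m => ‖inner ℂ (e m) (X (e j))‖ ^ 2)
        (fun m _ => by positivity) hj
    have h3 : (inner ℂ (e j) (X (e j))).re ^ 2 ≤ ‖inner ℂ (e j) (X (e j))‖ ^ 2 := by
      rw [← sq_abs]
      gcongr
      exact Complex.abs_re_le_norm _
    linarith [hX1 (e j)]
  have hin : (inner ℂ (e j) (ρ (e j))).re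
      = c + ((1 - c) * (inner ℂ (e j) (B (e j))).re - c * (inner ℂ (e j) (X (e j))).re) := by
    rw [hdec, inner_add_right, inner_sub_right, inner_smul_right, inner_smul_right,
      inner_smul_right, inner_self_eq_norm_sq_to_K, e.orthonormal.1 j]
    simp
  have hoff : ‖offProj e J (ρ (e j))‖ ^ 2
      ≤ (1 - c) * ‖offProj e J (B (e j))‖ ^ 2 + c * ‖offProj e J (X (e j))‖ ^ 2 := by
    rw [hdec, map_add, map_sub, map_smul, map_smul, map_smul, offProj_basis e.orthonormal hj,
      smul_zero, zero_add]
    set x := offProj e J (B (e j))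
    set y := offProj e J (X (e j))
    have h4 : ‖((1 - c : ℝ) : ℂ) • x - (c : ℂ) • y‖ ≤ (1 - c) * ‖x‖ + c * ‖y‖ := by
      refine (norm_sub_le _ _).trans (le_of_eq ?_)
      rw [norm_smul, norm_smul, Complex.norm_real, Complex.norm_real, Real.norm_of_nonneg hc1'.le,
        Real.norm_of_nonneg hc0.le]
    have h5 : ‖((1 - c : ℝ) : ℂ) • x - (c : ℂ) • y‖ ^ 2 ≤ ((1 - c) * ‖x‖ + c * ‖y‖) ^ 2 := by
      gcongr
    nlinarith [mul_nonneg (mul_nonneg hc0.le hc1'.le) (sq_nonneg (‖x‖ - ‖y‖))]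
  nlinarith

end Block

/-! ### The commutator convolution is a density operator -/

section Convolution

variable [CompleteSpace H] {ρ σ : H →L[ℂ] H} {t : ℝ}

section Density

variable {κ : Type*} (b : HilbertBasis κ ℂ H) {r : κ → ℝ}

theorem IsDensityOperator.norm_sq_le (hρ : IsDensityOperator ρ) (x : H) :
    ‖ρ x‖ ^ 2 ≤ (inner ℂ x (ρ x)).re := by
  obtain ⟨κ, b, r, hr⟩ := hρ.exists_eigenbasis
  exact norm_sq_le_re_inner_of_eigenbasis b hρ.isPositive.isSymmetric hr
    (hρ.eigenvalue_nonneg b hr) (hρ.eigenvalue_le_one b hr) x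

omit [CompleteSpace H] in
theorem commutatorConv_apply (x : H) : commutatorConv t ρ σ x =
    (t : ℂ) • ρ x + ((1 - t : ℝ) : ℂ) • σ x
      + (Complex.I * (√(t * (1 - t)) : ℂ)) • (ρ (σ x) - σ (ρ x)) := rfl

omit [CompleteSpace H] in
theorem re_inner_commutatorConv (hρ : ρ.toLinearMap.IsSymmetric) (hσ : σ.toLinearMap.IsSymmetric)
    (ht : 0 ≤ t) (x : H) :
    (inner ℂ x (commutatorConv t ρ σ x)).re = t * (inner ℂ x (ρ x)).re
      + (1 - t) * (inner ℂ x (σ x)).re - 2 * √t * √(1 - t) * (inner ℂ (ρ x) (σ x)).im := by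
  have h1 : inner ℂ x (ρ (σ x)) = inner ℂ (ρ x) (σ x) := (hρ x (σ x)).symm
  have h2 : inner ℂ x (σ (ρ x)) = (starRingEnd ℂ) (inner ℂ (ρ x) (σ x)) := by
    rw [inner_conj_symm]; exact (hσ x (ρ x)).symm
  rw [commutatorConv_apply, inner_add_right, inner_add_right, inner_smul_right, inner_smul_right,
    inner_smul_right, inner_sub_right, h1, h2, Real.sqrt_mul ht]
  simp [-inner_conj_symm]
  ring

/-- Cauchy-Schwarz and AM-GM bound the commutator term by `t ‖ρ x‖² + (1 - t) ‖σ x‖²`, and `ρ² ≤ ρ`,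
`σ² ≤ σ` absorb this into the diagonal terms. -/
theorem isPositive_commutatorConv (hρ : IsDensityOperator ρ) (hσ : IsDensityOperator σ)
    (ht : t ∈ Set.Icc (0 : ℝ) 1) : (commutatorConv t ρ σ).IsPositive := by
  have hρs : ∀ x y, inner ℂ (ρ x) y = inner ℂ x (ρ y) := hρ.isPositive.isSymmetric
  have hσs : ∀ x y, inner ℂ (σ x) y = inner ℂ x (σ y) := hσ.isPositive.isSymmetric
  have hsymm : ∀ x y, inner ℂ (commutatorConv t ρ σ x) y = inner ℂ x (commutatorConv t ρ σ y) := by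
    intro x y
    simp only [commutatorConv_apply, inner_add_left, inner_add_right, inner_smul_left,
      inner_smul_right, inner_sub_left, inner_sub_right, hρs, hσs, map_mul, Complex.conj_ofReal,
      Complex.conj_I]
    ring
  refine ⟨hsymm, fun x => ?_⟩
  rw [ContinuousLinearMap.reApplyInnerSelf_apply, hsymm]
  change 0 ≤ (inner ℂ x (commutatorConv t ρ σ x)).re
  rw [re_inner_commutatorConv hρ.isPositive.isSymmetric hσ.isPositive.isSymmetric ht.1]
  have h1 := mul_le_mul_of_nonneg_left (hρ.norm_sq_le x) ht.1
  have h2 := mul_le_mul_of_nonneg_left (hσ.norm_sq_le x) (sub_nonneg.2 ht.2)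
  have h3 := Complex.abs_im_le_norm (inner ℂ (ρ x) (σ x))
  have h4 := norm_inner_le_norm (𝕜 := ℂ) (ρ x) (σ x)
  have h5 : √t * √(1 - t) * (inner ℂ (ρ x) (σ x)).im ≤ √t * √(1 - t) * (‖ρ x‖ * ‖σ x‖) :=
    mul_le_mul_of_nonneg_left ((le_abs_self _).trans (h3.trans h4)) (by positivity)
  have h6 := Real.sq_sqrt ht.1
  have h7 := Real.sq_sqrt (sub_nonneg.2 ht.2)
  have h8 := sq_nonneg (√t * ‖ρ x‖ - √(1 - t) * ‖σ x‖)
  rw [sub_sq, mul_pow, mul_pow, h6, h7] at h8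
  linarith

theorem isDensityOperator_commutatorConv (hρ : IsDensityOperator ρ) (hσ : IsDensityOperator σ)
    (ht : t ∈ Set.Icc (0 : ℝ) 1) : IsDensityOperator (commutatorConv t ρ σ) := by
  have hpos := isPositive_commutatorConv hρ hσ ht
  refine ⟨hpos, ?_⟩
  obtain ⟨κ, b, r, hr⟩ := hρ.exists_eigenbasis
  have hs : HasSum (fun k => (inner ℂ (b k) (commutatorConv t ρ σ (b k))).re)
      (t * 1 + (1 - t) * 1) := by
    refine (((hρ.hasSum_inner b).mul_left t).add
      ((hσ.hasSum_inner b).mul_left (1 - t))).congr_fun fun k => ?_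
    -- In an eigenbasis of `ρ` the commutator has zero diagonal.
    have h0 : (inner ℂ (ρ (b k)) (σ (b k))).im = 0 := by
      have h1 : (inner ℂ (b k) (σ (b k))).im = 0 := by
        rw [← Complex.conj_eq_iff_im, inner_conj_symm]
        exact hσ.isPositive.isSymmetric (b k) (b k)
      rw [hr k, inner_smul_left, Complex.conj_ofReal, Complex.im_ofReal_mul, h1, mul_zero]
    rw [re_inner_commutatorConv hρ.isPositive.isSymmetric hσ.isPositive.isSymmetric ht.1, h0]
    ring
  rw [trace_eq b _ hpos, ← ENNReal.ofReal_tsum_of_nonneg _ hs.summable, hs.tsum_eq]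
  · simp
  · exact fun k => hpos.re_inner_nonneg_right (b k)

end Density

/-! ### The entropy inequality and its equality case -/

section Main

variable {κ κ' ι : Type*} {b : HilbertBasis κ ℂ H} {b' : HilbertBasis κ' ℂ H}
  {e : HilbertBasis ι ℂ H} {r : κ → ℝ} {s : κ' → ℝ} {l : ι → ℝ}

/-- The one-state inequalities for `ρ` and `σ` are averaged; their off-block terms pay for the
commutator. The slack is kept for the single index `i`, which is all the equality case needs. -/
theorem excess_commutatorConv_add_le (hρ : IsDensityOperator ρ) (hσ : IsDensityOperator σ)
    (ht : t ∈ Set.Icc (0 : ℝ) 1) (hr : ∀ k, ρ (b k) = (r k : ℂ) • b k)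
    (hs : ∀ k, σ (b' k) = (s k : ℂ) • b' k)
    (hl : ∀ k, commutatorConv t ρ σ (e k) = (l k : ℂ) • e k) {c : ℝ}
    (hc : c ∈ Set.Ioo (0 : ℝ) 1) {i : ι} (hi : c < l i) :
    excess l c
      + t * (c * (∑' k, max (c - r k) 0 / c * ‖inner ℂ (b k) (e i)‖ ^ 2) ^ 2)
      + (1 - t) * (c * (∑' k, max (c - s k) 0 / c * ‖inner ℂ (b' k) (e i)‖ ^ 2) ^ 2)
      ≤ t * excess r c + (1 - t) * excess s c := by
  have h1 : 0 ≤ 1 - t := sub_nonneg.2 ht.2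
  have hτ := isDensityOperator_commutatorConv hρ hσ ht
  -- The block is finite because the eigenvalues are summable and `c > 0`; eigenvalues equal to `c`
  -- contribute zero.
  have hfin : {k | ¬ l k < c}.Finite :=
    (hτ.hasSum_eigenvalue e hl).summable.tendsto_cofinite_zero.eventually (gt_mem_nhds hc.1)
  set J := hfin.toFinset with hJ
  have hex : excess l c = ∑ k ∈ J, (l k - c) := by
    rw [excess, tsum_eq_sum (s := J)]
    · refine Finset.sum_congr rfl fun k hk => max_eq_left ?_
      rw [hJ, Set.Finite.mem_toFinset] at hk
      exact sub_nonneg.2 (not_lt.1 hk)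
    · intro k hk
      rw [hJ, Set.Finite.mem_toFinset] at hk
      exact max_eq_right (sub_nonpos.2 (not_not.1 hk).le)
  have hiJ : i ∈ J := by
    rw [hJ, Set.Finite.mem_toFinset]
    exact not_lt.2 hi.le
  have h2 := sum_im_inner_le (J := J) e.orthonormal hρ.isPositive.isSymmetric
    hσ.isPositive.isSymmetric (√t) (√(1 - t))
  rw [Real.sq_sqrt ht.1, Real.sq_sqrt h1] at h2
  have h3 := mul_le_mul_of_nonneg_left (sum_re_inner_sub_le b e hρ hr hc J) ht.1
  have h4 := mul_le_mul_of_nonneg_left (sum_re_inner_sub_le b' e hσ hs hc J) h1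
  have h5 := mul_le_mul_of_nonneg_left (Finset.single_le_sum (f := fun j =>
    c * (∑' k, max (c - r k) 0 / c * ‖inner ℂ (b k) (e j)‖ ^ 2) ^ 2)
    (fun j _ => mul_nonneg hc.1.le (sq_nonneg _)) hiJ) ht.1
  have h6 := mul_le_mul_of_nonneg_left (Finset.single_le_sum (f := fun j =>
    c * (∑' k, max (c - s k) 0 / c * ‖inner ℂ (b' k) (e j)‖ ^ 2) ^ 2)
    (fun j _ => mul_nonneg hc.1.le (sq_nonneg _)) hiJ) h1
  have h7 : ∑ k ∈ J, (l k - c) = t * ∑ j ∈ J, ((inner ℂ (e j) (ρ (e j))).re - c)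
      + (1 - t) * ∑ j ∈ J, ((inner ℂ (e j) (σ (e j))).re - c)
      + ∑ j ∈ J, -(2 * √t * √(1 - t) * (inner ℂ (ρ (e j)) (σ (e j))).im) := by
    rw [Finset.mul_sum, Finset.mul_sum, ← Finset.sum_add_distrib, ← Finset.sum_add_distrib]
    refine Finset.sum_congr rfl fun j _ => ?_
    rw [← re_inner_eigenvector e hl j,
      re_inner_commutatorConv hρ.isPositive.isSymmetric hσ.isPositive.isSymmetric ht.1]
    ring
  rw [Finset.sum_add_distrib, ← Finset.mul_sum, ← Finset.mul_sum] at h2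
  rw [Finset.sum_add_distrib, Finset.sum_add_distrib, mul_add, mul_add] at h3 h4
  linarith

theorem excess_commutatorConv_le (hρ : IsDensityOperator ρ) (hσ : IsDensityOperator σ)
    (ht : t ∈ Set.Icc (0 : ℝ) 1) (hr : ∀ k, ρ (b k) = (r k : ℂ) • b k)
    (hs : ∀ k, σ (b' k) = (s k : ℂ) • b' k)
    (hl : ∀ k, commutatorConv t ρ σ (e k) = (l k : ℂ) • e k) {c : ℝ}
    (hc : c ∈ Set.Ioo (0 : ℝ) 1) :
    excess l c ≤ t * excess r c + (1 - t) * excess s c := by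
  have h1 : 0 ≤ 1 - t := sub_nonneg.2 ht.2
  by_cases h : ∃ i, c < l i
  · obtain ⟨i, hi⟩ := h
    have h2 := excess_commutatorConv_add_le hρ hσ ht hr hs hl hc hi
    have h3 := mul_nonneg ht.1 (mul_nonneg hc.1.le
      (sq_nonneg (∑' k, max (c - r k) 0 / c * ‖inner ℂ (b k) (e i)‖ ^ 2)))
    have h4 := mul_nonneg h1 (mul_nonneg hc.1.le
      (sq_nonneg (∑' k, max (c - s k) 0 / c * ‖inner ℂ (b' k) (e i)‖ ^ 2)))
    linarith
  · push Not at h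
    have h2 : excess l c = 0 := by
      exact (tsum_congr fun k => max_eq_right (sub_nonpos.2 (h k))).trans tsum_zero
    rw [h2]
    exact add_nonneg (mul_nonneg ht.1 (excess_nonneg _ _)) (mul_nonneg h1 (excess_nonneg _ _))

/-- If the eigenvectors of `ρ` only overlap with eigenvectors of `τ` of smaller or equal eigenvalue,
then the two density operators are equal. -/
theorem eq_of_inner_eq_zero {τ : H →L[ℂ] H} (hρ : IsDensityOperator ρ) (hτ : IsDensityOperator τ)
    (hr : ∀ k, ρ (b k) = (r k : ℂ) • b k) (hl : ∀ i, τ (e i) = (l i : ℂ) • e i)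
    (h : ∀ k i, r k < l i → inner ℂ (b k) (e i) = 0) : ρ = τ := by
  have hsymm := hρ.isPositive.isSymmetric
  have hle : ∀ k i, l i * ‖inner ℂ (b k) (e i)‖ ^ 2 ≤ r k * ‖inner ℂ (b k) (e i)‖ ^ 2 := by
    intro k i
    rcases lt_or_ge (r k) (l i) with hlt | hge
    · simp [h k i hlt]
    · gcongr
  have h1 : ∀ i, HasSum (fun k => l i * ‖inner ℂ (b k) (e i)‖ ^ 2) (l i) := fun i => by
    simpa [e.orthonormal.1 i] using (hasSum_norm_inner_sq b (e i)).mul_left (l i)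
  have h2 := fun i => hasSum_re_inner_eigenbasis b hsymm hr (e i)
  have h3 : ∀ i, l i ≤ (inner ℂ (e i) (ρ (e i))).re := fun i =>
    hasSum_le (fun k => hle k i) (h1 i) (h2 i)
  -- Both sides sum to one, so the termwise inequalities are equalities.
  have h4 : ∀ i, l i = (inner ℂ (e i) (ρ (e i))).re := by
    have h5 := (hρ.hasSum_inner e).sub (hτ.hasSum_eigenvalue e hl)
    rw [sub_self, hasSum_zero_iff_of_nonneg fun i => sub_nonneg.2 (h3 i)] at h5
    exact fun i => (sub_eq_zero.1 (congrFun h5 i)).symm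
  refine ext_hilbertBasis e fun i => ?_
  have h6 : ∀ k, l i * ‖inner ℂ (b k) (e i)‖ ^ 2 = r k * ‖inner ℂ (b k) (e i)‖ ^ 2 := by
    have h7 := (h2 i).sub (h1 i)
    rw [← h4 i, sub_self, hasSum_zero_iff_of_nonneg fun k => sub_nonneg.2 (hle k i)] at h7
    exact fun k => (sub_eq_zero.1 (congrFun h7 k)).symm
  rw [hl i]
  refine b.repr.injective (lp.ext (funext fun k => ?_))
  rw [HilbertBasis.repr_apply_apply, HilbertBasis.repr_apply_apply,
    inner_eigenvector hsymm (hr k), inner_smul_right]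
  rcases eq_or_ne (inner ℂ (b k) (e i)) 0 with h0 | h0
  · rw [h0, mul_zero, mul_zero]
  · have := mul_right_cancel₀ (pow_ne_zero 2 (norm_ne_zero_iff.2 h0)) (h6 k)
    rw [this]

/-- The sum is `⟨x, X x⟩` with `X = (c - ρ)₊ / c`; all its terms are nonnegative, and the weight is
positive when `r k < c`. -/
theorem inner_eq_zero_of_tsum_eq_zero (hρ : IsDensityOperator ρ)
    (hr : ∀ k, ρ (b k) = (r k : ℂ) • b k) {c : ℝ} (hc : 0 < c) {x : H}
    (h : (∑' k, max (c - r k) 0 / c * ‖inner ℂ (b k) x‖ ^ 2) = 0) {k : κ} (hk : r k < c) :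
    inner ℂ (b k) x = 0 := by
  have h0 : ∀ k, 0 ≤ max (c - r k) 0 / c * ‖inner ℂ (b k) x‖ ^ 2 := fun k => by positivity
  have hs : Summable fun k => max (c - r k) 0 / c * ‖inner ℂ (b k) x‖ ^ 2 := by
    refine (hasSum_norm_inner_sq b x).summable.of_nonneg_of_le h0 fun k => ?_
    refine mul_le_of_le_one_left (by positivity) ((div_le_one hc).2 (max_le ?_ hc.le))
    linarith [hρ.eigenvalue_nonneg b hr k]
  have h1 := congrFun ((hasSum_zero_iff_of_nonneg h0).1 (h ▸ hs.hasSum)) k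
  have h2 : 0 < max (c - r k) 0 / c := div_pos (lt_max_of_lt_left (sub_pos.2 hk)) hc
  have h3 := (mul_eq_zero.1 h1).resolve_left h2.ne'
  exact norm_eq_zero.1 (pow_eq_zero_iff two_ne_zero |>.1 h3)

theorem IsDensityOperator.entropyIntegrand_nonneg (hρ : IsDensityOperator ρ)
    (b : HilbertBasis κ ℂ H) (hr : ∀ k, ρ (b k) = (r k : ℂ) • b k) {c : ℝ}
    (hc : c ∈ Set.Ioo (0 : ℝ) 1) : 0 ≤ (1 - c - excess r c) / c :=
  div_nonneg (sub_nonneg.2 (excess_le (hρ.eigenvalue_nonneg b hr)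
    (hρ.eigenvalue_le_one b hr) (hρ.hasSum_eigenvalue b hr) hc.1.le hc.2.le)) hc.1.le

theorem IsDensityOperator.aemeasurable_entropyIntegrand (hρ : IsDensityOperator ρ)
    (b : HilbertBasis κ ℂ H) (hr : ∀ k, ρ (b k) = (r k : ℂ) • b k) :
    AEMeasurable (fun c => ENNReal.ofReal ((1 - c - excess r c) / c))
      (MeasureTheory.volume.restrict (Set.Ioo (0 : ℝ) 1)) := by
  have hm : AEMeasurable (excess r) (MeasureTheory.volume.restrict (Set.Ioo (0 : ℝ) 1)) := by
    refine aemeasurable_restrict_of_antitoneOn measurableSet_Ioo fun c hc c' hc' hcc => ?_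
    have hsum : ∀ {c : ℝ}, 0 ≤ c → Summable fun k => max (r k - c) 0 := fun h =>
      summable_excess (hρ.eigenvalue_nonneg b hr) (hρ.hasSum_eigenvalue b hr).summable h
    exact (hsum hc'.1.le).tsum_le_tsum
      (fun k => max_le_max (sub_le_sub_left hcc _) le_rfl) (hsum hc.1.le)
  exact (((aemeasurable_const.sub aemeasurable_id).sub hm).div aemeasurable_id).ennreal_ofReal

theorem lintegral_excess_combination [Countable κ] [Countable κ'] (hρ : IsDensityOperator ρ)
    (hσ : IsDensityOperator σ) (ht : t ∈ Set.Icc (0 : ℝ) 1)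
    (hr : ∀ k, ρ (b k) = (r k : ℂ) • b k) (hs : ∀ k, σ (b' k) = (s k : ℂ) • b' k) :
    ENNReal.ofReal t * vonNeumannEntropy ρ + ENNReal.ofReal (1 - t) * vonNeumannEntropy σ =
      ∫⁻ c in Set.Ioo (0 : ℝ) 1,
        ENNReal.ofReal ((1 - c - (t * excess r c + (1 - t) * excess s c)) / c) := by
  have h1 : 0 ≤ 1 - t := sub_nonneg.2 ht.2
  rw [vonNeumannEntropy_eq_lintegral b hρ hr, vonNeumannEntropy_eq_lintegral b' hσ hs,
    ← MeasureTheory.lintegral_const_mul' _ _ ENNReal.ofReal_ne_top,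
    ← MeasureTheory.lintegral_const_mul' _ _ ENNReal.ofReal_ne_top,
    ← MeasureTheory.lintegral_add_left'
      ((hρ.aemeasurable_entropyIntegrand b hr).const_mul _)]
  refine MeasureTheory.setLIntegral_congr_fun measurableSet_Ioo fun c hc => ?_
  rw [← ENNReal.ofReal_mul ht.1, ← ENNReal.ofReal_mul h1,
    ← ENNReal.ofReal_add (mul_nonneg ht.1 (hρ.entropyIntegrand_nonneg b hr hc))
      (mul_nonneg h1 (hσ.entropyIntegrand_nonneg b' hs hc))]
  congr 1
  ring

theorem vonNeumannEntropy_commutatorConv_ge [TopologicalSpace.SeparableSpace H]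
    (hρ : IsDensityOperator ρ) (hσ : IsDensityOperator σ) (ht : t ∈ Set.Icc (0 : ℝ) 1) :
    ENNReal.ofReal t * vonNeumannEntropy ρ + ENNReal.ofReal (1 - t) * vonNeumannEntropy σ
      ≤ vonNeumannEntropy (commutatorConv t ρ σ) := by
  have hτ := isDensityOperator_commutatorConv hρ hσ ht
  obtain ⟨κ, b, r, hr⟩ := hρ.exists_eigenbasis
  obtain ⟨κ', b', s, hs⟩ := hσ.exists_eigenbasis
  obtain ⟨ι, e, l, hl⟩ := hτ.exists_eigenbasis
  have := countable_of_hilbertBasis b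
  have := countable_of_hilbertBasis b'
  have := countable_of_hilbertBasis e
  rw [lintegral_excess_combination hρ hσ ht hr hs, vonNeumannEntropy_eq_lintegral e hτ hl]
  refine MeasureTheory.setLIntegral_mono' measurableSet_Ioo fun c hc => ?_
  have := excess_commutatorConv_le hρ hσ ht hr hs hl hc
  have hc0 := hc.1
  gcongr

theorem eq_of_vonNeumannEntropy_commutatorConv_eq [TopologicalSpace.SeparableSpace H]
    (hρ : IsDensityOperator ρ) (hσ : IsDensityOperator σ) (ht : t ∈ Set.Ioo (0 : ℝ) 1)
    (hfin : vonNeumannEntropy (commutatorConv t ρ σ) ≠ ⊤)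
    (heq : vonNeumannEntropy (commutatorConv t ρ σ)
      = ENNReal.ofReal t * vonNeumannEntropy ρ + ENNReal.ofReal (1 - t) * vonNeumannEntropy σ) :
    ρ = σ := by
  have ht' := Set.Ioo_subset_Icc_self ht
  have hτ := isDensityOperator_commutatorConv hρ hσ ht'
  obtain ⟨κ, b, r, hr⟩ := hρ.exists_eigenbasis
  obtain ⟨κ', b', s, hs⟩ := hσ.exists_eigenbasis
  obtain ⟨ι, e, l, hl⟩ := hτ.exists_eigenbasis
  have := countable_of_hilbertBasis b
  have := countable_of_hilbertBasis b'
  have := countable_of_hilbertBasis e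
  have hl1 := hτ.eigenvalue_le_one e hl
  rw [lintegral_excess_combination hρ hσ ht' hr hs] at heq
  have hint := vonNeumannEntropy_eq_lintegral e hτ hl
  -- Ordered integrands with equal finite integrals agree almost everywhere; this is where finite
  -- entropy enters.
  have hae := MeasureTheory.ae_eq_of_ae_le_of_lintegral_le
    (μ := MeasureTheory.volume.restrict (Set.Ioo (0 : ℝ) 1))
    (f := fun c => ENNReal.ofReal ((1 - c - (t * excess r c + (1 - t) * excess s c)) / c))
    (g := fun c => ENNReal.ofReal ((1 - c - excess l c) / c))
    ((MeasureTheory.ae_restrict_iff' measurableSet_Ioo).2 <| Filter.Eventually.of_forall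
      fun c hc => by
        have := excess_commutatorConv_le hρ hσ ht' hr hs hl hc
        have hc0 := hc.1
        exact ENNReal.ofReal_le_ofReal
          (div_le_div_of_nonneg_right (sub_le_sub_left this _) hc0.le))
    (heq ▸ hfin) (hτ.aemeasurable_entropyIntegrand e hl) (by rw [← hint, ← heq])
  rw [Filter.EventuallyEq, MeasureTheory.ae_restrict_iff' measurableSet_Ioo] at hae
  -- A set of full measure is dense, so a level `c` with equality can be found between any two
  -- distinct eigenvalues `r k < l i` or `s k < l i`.
  have hgood : ∀ x i, 0 ≤ x → x < l i → ∃ c ∈ Set.Ioo (0 : ℝ) 1, x < c ∧ c < l i ∧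
      excess l c = t * excess r c + (1 - t) * excess s c := by
    intro x i hx hxl
    obtain ⟨c, hcP, hcI⟩ := (MeasureTheory.Measure.dense_of_ae hae).exists_mem_open isOpen_Ioo
      (Set.nonempty_Ioo.2 hxl)
    have hc : c ∈ Set.Ioo (0 : ℝ) 1 := ⟨hx.trans_lt hcI.1, hcI.2.trans_le (hl1 i)⟩
    refine ⟨c, hc, hcI.1, hcI.2, ?_⟩
    have h1 : 0 ≤ (1 - c - excess l c) / c := hτ.entropyIntegrand_nonneg e hl hc
    have h2 : (1 - c - excess l c) / c
        = (1 - c - (t * excess r c + (1 - t) * excess s c)) / c := by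
      have h3 := excess_commutatorConv_le hρ hσ ht' hr hs hl hc
      have h4 : 0 ≤ (1 - c - (t * excess r c + (1 - t) * excess s c)) / c := by
        have h5 := mul_nonneg ht'.1 (hρ.entropyIntegrand_nonneg b hr hc)
        have h6 := mul_nonneg (sub_nonneg.2 ht'.2) (hσ.entropyIntegrand_nonneg b' hs hc)
        have h7 : (1 - c - (t * excess r c + (1 - t) * excess s c)) / c
            = t * ((1 - c - excess r c) / c) + (1 - t) * ((1 - c - excess s c) / c) := by ring
        exact h7 ▸ add_nonneg h5 h6
      exact ((ENNReal.ofReal_eq_ofReal_iff h4 h1).1 (hcP hc)).symm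
    have h3 := (div_left_inj' hc.1.ne').1 h2
    linarith
  have hzero : ∀ c ∈ Set.Ioo (0 : ℝ) 1, ∀ i, c < l i →
      excess l c = t * excess r c + (1 - t) * excess s c →
      (∑' k, max (c - r k) 0 / c * ‖inner ℂ (b k) (e i)‖ ^ 2) = 0 ∧
      (∑' k, max (c - s k) 0 / c * ‖inner ℂ (b' k) (e i)‖ ^ 2) = 0 := by
    intro c hc i hci hce
    have h1 := excess_commutatorConv_add_le hρ hσ ht' hr hs hl hc hci
    have ht1 := sub_pos.2 ht.2
    have h2 : ∀ x : ℝ, 0 ≤ c * x ^ 2 := fun x => mul_nonneg hc.1.le (sq_nonneg x)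
    have h3 : ∀ x : ℝ, c * x ^ 2 = 0 → x = 0 := fun x hx =>
      (pow_eq_zero_iff two_ne_zero).1 ((mul_eq_zero.1 hx).resolve_left hc.1.ne')
    set x := ∑' k, max (c - r k) 0 / c * ‖inner ℂ (b k) (e i)‖ ^ 2
    set y := ∑' k, max (c - s k) 0 / c * ‖inner ℂ (b' k) (e i)‖ ^ 2
    have h4 := mul_nonneg ht.1.le (h2 x)
    have h5 := mul_nonneg ht1.le (h2 y)
    exact ⟨h3 x ((mul_eq_zero.1 (by linarith)).resolve_left ht.1.ne'),
      h3 y ((mul_eq_zero.1 (by linarith)).resolve_left ht1.ne')⟩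
  have hr' : ∀ k i, r k < l i → inner ℂ (b k) (e i) = 0 := by
    intro k i hki
    obtain ⟨c, hc, hkc, hci, hce⟩ := hgood _ i (hρ.eigenvalue_nonneg b hr k) hki
    refine inner_eq_zero_of_tsum_eq_zero hρ hr hc.1 (hzero c hc i hci hce).1 hkc
  have hs' : ∀ k i, s k < l i → inner ℂ (b' k) (e i) = 0 := by
    intro k i hki
    obtain ⟨c, hc, hkc, hci, hce⟩ := hgood _ i (hσ.eigenvalue_nonneg b' hs k) hki
    refine inner_eq_zero_of_tsum_eq_zero hσ hs hc.1 (hzero c hc i hci hce).2 hkc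
  exact (eq_of_inner_eq_zero hρ hτ hr hl hr').trans (eq_of_inner_eq_zero hσ hτ hs hl hs').symm

end Main

end Convolution

/-! ### The partial trace of the partial swap -/

theorem inner_tmul (x y x' y' : H) :
    inner ℂ (tmul x y) (tmul x' y') = inner ℂ x x' * inner ℂ y y' := by
  simp [tmul, UniformSpace.Completion.inner_coe]

theorem inner_swapOp_swapOp (z w : HilbertTensor H) :
    inner ℂ (swapOp H z) (swapOp H w) = inner ℂ z w := by
  induction z, w using UniformSpace.Completion.induction_on₂ with
  | hp => exact isClosed_eq (by fun_prop) (by fun_prop)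
  | ih a b =>
    simp [swapOp, UniformSpace.Completion.inner_coe]

theorem adjoint_swapOp_tmul (x y : H) :
    ContinuousLinearMap.adjoint (swapOp H) (tmul x y) = tmul y x := by
  refine ext_inner_right ℂ fun z => ?_
  rw [ContinuousLinearMap.adjoint_inner_left, ← swapOp_tmul y x, inner_swapOp_swapOp]

theorem adjoint_partialSwap_tmul (t : ℝ) (x y : H) :
    ContinuousLinearMap.adjoint (partialSwap H t) (tmul x y)
      = (√t : ℂ) • tmul x y - (Complex.I * (√(1 - t) : ℂ)) • tmul y x := by
  rw [partialSwap, map_add, map_smulₛₗ, map_smulₛₗ, add_apply, smul_apply, smul_apply,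
    adjoint_swapOp_tmul, ContinuousLinearMap.adjoint_id]
  simp [sub_eq_add_neg]

variable [CompleteSpace H] {ρ σ : H →L[ℂ] H} {t : ℝ}

theorem IsDensityOperator.hasSum_inner_complex {κ : Type*} (b : HilbertBasis κ ℂ H)
    (hρ : IsDensityOperator ρ) : HasSum (fun k => inner ℂ (b k) (ρ (b k))) (1 : ℂ) := by
  have h := Complex.hasSum_ofReal.2 (hρ.hasSum_inner b)
  rw [Complex.ofReal_one] at h
  refine h.congr_fun fun k => ?_
  refine (Complex.conj_eq_iff_re.1 ?_).symm
  rw [inner_conj_symm]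
  exact hρ.isPositive.isSymmetric (b k) (b k)

/-- Conjugation by `U_t` gives four terms: the two diagonal ones produce `Tr σ` and `Tr ρ`, the two
cross terms produce `ρσ` and `σρ` by Parseval. The commutator appears as `[σ, ρ]`, opposite to the
sign in `commutatorConv t ρ σ`, hence the exchanged roles and the parameter `1 - t`. -/
theorem isPartialTrace_partialSwap (hρ : IsDensityOperator ρ) (hσ : IsDensityOperator σ)
    (ht : t ∈ Set.Icc (0 : ℝ) 1) :
    IsPartialTrace
      (partialSwap H t ∘L tensorOp ρ σ ∘L ContinuousLinearMap.adjoint (partialSwap H t))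
      (commutatorConv (1 - t) σ ρ) := by
  intro ι b x y
  have hρs : ∀ x y, inner ℂ (ρ x) y = inner ℂ x (ρ y) := hρ.isPositive.isSymmetric
  have hσs : ∀ x y, inner ℂ (σ x) y = inner ℂ x (σ y) := hσ.isPositive.isSymmetric
  have h1 : (√t : ℂ) * √t = t := by rw [← Complex.ofReal_mul, Real.mul_self_sqrt ht.1]
  have h2 : (√(1 - t) : ℂ) * √(1 - t) = ((1 - t : ℝ) : ℂ) := by
    rw [← Complex.ofReal_mul, Real.mul_self_sqrt (sub_nonneg.2 ht.2)]
  have a1 := (hσ.hasSum_inner_complex b).mul_left ((t : ℂ) * inner ℂ x (ρ y))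
  have a2 := (hρ.hasSum_inner_complex b).mul_left (((1 - t : ℝ) : ℂ) * inner ℂ x (σ y))
  have a3 := (b.hasSum_inner_mul_inner (ρ x) (σ y)).mul_left
    (-(Complex.I * (√(1 - t) : ℂ) * √t))
  have a4 := (b.hasSum_inner_mul_inner (σ x) (ρ y)).mul_left
    (Complex.I * (√(1 - t) : ℂ) * √t)
  have hval : inner ℂ x (commutatorConv (1 - t) σ ρ y)
      = (t : ℂ) * inner ℂ x (ρ y) * 1 + ((1 - t : ℝ) : ℂ) * inner ℂ x (σ y) * 1
        + -(Complex.I * (√(1 - t) : ℂ) * √t) * inner ℂ (ρ x) (σ y)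
        + Complex.I * (√(1 - t) : ℂ) * √t * inner ℂ (σ x) (ρ y) := by
    rw [commutatorConv_apply, inner_add_right, inner_add_right, inner_smul_right,
      inner_smul_right, inner_smul_right, inner_sub_right, hρs, hσs,
      Real.sqrt_mul (sub_nonneg.2 ht.2), sub_sub_cancel, Complex.ofReal_mul]
    ring
  rw [hval]
  refine (((a1.add a2).add a3).add a4).congr_fun fun i => ?_
  -- Moving the outer `U_t` to the left slot leaves only its adjoint, applied to elementary tensors
  -- on both sides.
  rw [ContinuousLinearMap.comp_apply, ← ContinuousLinearMap.adjoint_inner_left,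
    ContinuousLinearMap.comp_apply, adjoint_partialSwap_tmul, adjoint_partialSwap_tmul]
  simp only [map_sub, map_smul, tensorOp_tmul, inner_sub_left, inner_sub_right, inner_smul_left,
    inner_smul_right, inner_tmul, map_mul, Complex.conj_ofReal, Complex.conj_I, hρs, hσs]
  rw [← h1, ← h2]
  ring_nf
  simp only [Complex.I_sq]
  ring

theorem partialSwapConv_eq (hρ : IsDensityOperator ρ) (hσ : IsDensityOperator σ)
    (ht : t ∈ Set.Icc (0 : ℝ) 1) : partialSwapConv t ρ σ = commutatorConv (1 - t) σ ρ := by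
  have h := isPartialTrace_partialSwap hρ hσ ht
  have hex : ∃ τ, IsPartialTrace
      (partialSwap H t ∘L tensorOp ρ σ ∘L ContinuousLinearMap.adjoint (partialSwap H t)) τ := ⟨_, h⟩
  rw [partialSwapConv, partialTrace, dif_pos hex]
  exact hex.choose_spec.unique h

omit [CompleteSpace H] in
theorem commutatorConv_self : commutatorConv t ρ ρ = ρ := by
  ext x
  rw [commutatorConv_apply, sub_self, smul_zero, add_zero, ← add_smul]
  simp

theorem entropy_power_commutatorConv [TopologicalSpace.SeparableSpace H]
    (hρ : IsDensityOperator ρ) (hσ : IsDensityOperator σ) (ht : t ∈ Set.Icc (0 : ℝ) 1) :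
    IsDensityOperator (commutatorConv t ρ σ) ∧
      ENNReal.ofReal t * vonNeumannEntropy ρ + ENNReal.ofReal (1 - t) * vonNeumannEntropy σ
        ≤ vonNeumannEntropy (commutatorConv t ρ σ) ∧
      (t ∈ Set.Ioo (0 : ℝ) 1 → vonNeumannEntropy (commutatorConv t ρ σ) ≠ ⊤ →
        (vonNeumannEntropy (commutatorConv t ρ σ)
            = ENNReal.ofReal t * vonNeumannEntropy ρ
              + ENNReal.ofReal (1 - t) * vonNeumannEntropy σ
          ↔ ρ = σ)) := by
  refine ⟨isDensityOperator_commutatorConv hρ hσ ht,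
    vonNeumannEntropy_commutatorConv_ge hρ hσ ht, fun ht' hfin => ⟨fun h =>
      eq_of_vonNeumannEntropy_commutatorConv_eq hρ hσ ht' hfin h, ?_⟩⟩
  rintro rfl
  rw [commutatorConv_self, ← add_mul, ← ENNReal.ofReal_add ht.1 (sub_nonneg.2 ht.2)]
  simp

end QuantumEPI

end

open QuantumEPI in
theorem mainTheorem3 {H : Type u} [NormedAddCommGroup H] [InnerProductSpace ℂ H]
    [CompleteSpace H] [TopologicalSpace.SeparableSpace H]
    (ρ σ : H →L[ℂ] H) (hρ : IsDensityOperator ρ) (hσ : IsDensityOperator σ)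
    (t : ℝ) (ht : t ∈ Set.Icc (0 : ℝ) 1) :
    ∀ τ ∈ ({partialSwapConv t ρ σ, commutatorConv t ρ σ} : Set (H →L[ℂ] H)),
      IsDensityOperator τ ∧
      ENNReal.ofReal t * vonNeumannEntropy ρ + ENNReal.ofReal (1 - t) * vonNeumannEntropy σ
        ≤ vonNeumannEntropy τ ∧
      (t ∈ Set.Ioo (0 : ℝ) 1 → vonNeumannEntropy τ ≠ ⊤ →
        (vonNeumannEntropy τ
            = ENNReal.ofReal t * vonNeumannEntropy ρ
              + ENNReal.ofReal (1 - t) * vonNeumannEntropy σ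
          ↔ ρ = σ)) := by
  rintro τ (rfl | rfl)
  · obtain ⟨h1, h2, h3⟩ := entropy_power_commutatorConv (t := 1 - t) hσ hρ
      ⟨sub_nonneg.2 ht.2, sub_le_self 1 ht.1⟩
    rw [sub_sub_cancel, add_comm] at h2 h3
    rw [partialSwapConv_eq hρ hσ ht]
    refine ⟨h1, h2, fun ht' hfin => ?_⟩
    exact (h3 ⟨sub_pos.2 ht'.2, sub_lt_self 1 ht'.1⟩ hfin).trans eq_comm
  · exact entropy_power_commutatorConv hρ hσ ht
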